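/- Let $(\Omega,\mathcal F,\mathbb P)$ be a probability space and let $\xi\ge 0$ be a random variable with $\mathbb E[\xi]=1$ (the density of a martingale measure). For a random variable $X$ with distribution function $F_X$ put $F_X^{-1}(u)=\inf\{x\in\mathbb R: F_X(x)\ge u\}$, $\mathrm{VaR}_u(X)=-F_X^{-1}(u)$ and $\mathrm{CVaR}_\beta(X)=\frac1\beta\int_0^\beta \mathrm{VaR}_u(X)\,du$ for $0<\beta\le1$. Let $\mu$ be a probability measure on $[0,1]$ with $\mu(\{0\})=0$, let $$\rho_\mu(X)=\int_0^1\mathrm{CVaR}_u(X)\,\mu(du)$$ be the associated spectral risk measure (for $X\le 0$ it takes values in $[0,+\infty]$), and put $\phi(x)=\int_{(x,1]}\frac{\mu(ds)}{s}$ for $x>0$. Let $\rho_0>\rho_\mu(0)$ $(=0)$ be a real number. For $A\in\mathcal F$ let $$\Delta(A)=\inf\big\{\mathbb E[\xi Y]:\ Y\in L^1(\xi\mathbb P),\ \rho_\mu(Y)\le\rho_0,\ Y=0\text{ on }A,\ Y\le 0\text{ on }A^c\big\}\in[-\infty,+\infty].$$ Lemma 4.1. Let $A\in\mathcal F$ with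 $\mathbb P(A)<1$, put $\alpha_A=\mathbb P(A^c)$ and let $\hat F_\xi$ be the conditional distribution function of $\xi$ given $A^c$. (i) If the limit $\ell=\lim_{x\to0^+}\hat F_\xi^{-1}(1-x)/\phi(x)$ exists in $[0,+\infty]$, then $\Delta(A)$ is finite if and only if $\ell<+\infty$. (ii) If $\Delta(A)$ is finite, then $$\Delta(A)=-\rho_0\max_{x\in[0,1]}r(x),\qquad r(x)=\frac{\alpha_A}{\int_0^{\alpha_A x}\phi(u)\,du}\int_0^x\hat F_\xi^{-1}(1-u)\,du\quad(0<x\le1),$$ where $r(0)$ (formally $0/0$) is understood as $\limsup_{x\to0^+}r(x)$, that is, as $r(0^+)$ whenever this limit exists. In particular the maximum is finite and attained. -/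

import Mathlib

open MeasureTheory ProbabilityTheory Filter Topology Set

noncomputable section

namespace SpectralRisk

/-- Generalized inverse distribution function `F_X⁻¹(u) = inf {x : F_X(x) ≥ u}` of the random
variable `X` under the probability measure `P`. For `0 < u < 1` the set is nonempty and bounded
below, so this is the true infimum; all integrals and limits below only see such `u`. -/
def quantile {Ω : Type*} [MeasurableSpace Ω] (P : Measure Ω) (X : Ω → ℝ) (u : ℝ) : ℝ :=
  sInf {x : ℝ | u ≤ cdf (P.map X) x}

/-- Value at risk, `VaR_u(X) = - F_X⁻¹(u)`. -/
def VaR {Ω : Type*} [MeasurableSpace Ω] (P : Measure Ω) (u : ℝ) (X : Ω → ℝ) : ℝ :=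
  -quantile P X u

/-- Integral of an extended-real function: integral of the positive part minus integral of the
negative part, with the value `+∞` whenever the positive part has an infinite integral. -/
def extIntegral {α : Type*} [MeasurableSpace α] (ν : Measure α) (f : α → EReal) : EReal :=
  open Classical in
  if ∫⁻ a, (f a).toENNReal ∂ν = ⊤ then ⊤
  else ((∫⁻ a, (f a).toENNReal ∂ν : ENNReal) : EReal)
    - ((∫⁻ a, (-f a).toENNReal ∂ν : ENNReal) : EReal)

/-- `CVaR_β(X) = (1/β) ∫_0^β VaR_u(X) du` for `0 < β ≤ 1`, possibly `+∞`. -/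
def CVaR {Ω : Type*} [MeasurableSpace Ω] (P : Measure Ω) (β : ℝ) (X : Ω → ℝ) : EReal :=
  ((β⁻¹ : ℝ) : EReal) *
    extIntegral (volume.restrict (Ioo 0 β)) (fun u => ((VaR P u X : ℝ) : EReal))

/-- The spectral risk measure `ρ_μ(X) = ∫ CVaR_u(X) μ(du)`. -/
def spectralRisk {Ω : Type*} [MeasurableSpace Ω] (P : Measure Ω) (μ : Measure ℝ) (X : Ω → ℝ) :
    EReal :=
  extIntegral μ (fun β => CVaR P β X)

/-- The spectrum `φ(x) = ∫_{(x,1]} μ(ds)/s`, used for `x > 0` (where it is at most `1/x`). -/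
def spectrum (μ : Measure ℝ) (x : ℝ) : ℝ :=
  ∫ s in Ioc x 1, s⁻¹ ∂μ

/-- The feasible set `H₂(A)`: random variables `Y ∈ L¹(ξP)` with `ρ_μ(Y) ≤ ρ₀`, `Y = 0` on `A` and
`Y ≤ 0` on `Aᶜ`. -/
def feasible {Ω : Type*} [MeasurableSpace Ω] (P : Measure Ω) (ξ : Ω → ℝ) (μ : Measure ℝ)
    (ρ₀ : ℝ) (A : Set Ω) : Set (Ω → ℝ) :=
  {Y | AEMeasurable Y P ∧ Integrable (fun ω => ξ ω * Y ω) P ∧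
    spectralRisk P μ Y ≤ (ρ₀ : EReal) ∧
    (∀ᵐ ω ∂P, ω ∈ A → Y ω = 0) ∧ (∀ᵐ ω ∂P, ω ∈ Aᶜ → Y ω ≤ 0)}

/-- `Δ(A) = inf {E[ξ Y] : Y ∈ H₂(A)}`, in the extended reals. -/
def Delta {Ω : Type*} [MeasurableSpace Ω] (P : Measure Ω) (ξ : Ω → ℝ) (μ : Measure ℝ)
    (ρ₀ : ℝ) (A : Set Ω) : EReal :=
  ⨅ Y ∈ feasible P ξ μ ρ₀ A, ((∫ ω, ξ ω * Y ω ∂P : ℝ) : EReal)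

/-- `F̂_ξ⁻¹`: generalized inverse of the conditional distribution function of `ξ` given `Aᶜ`. -/
def condQuantile {Ω : Type*} [MeasurableSpace Ω] (P : Measure Ω) (ξ : Ω → ℝ) (A : Set Ω)
    (u : ℝ) : ℝ :=
  quantile (ProbabilityTheory.cond P Aᶜ) ξ u

/-- The quotient `α_A ∫_0^x F̂_ξ⁻¹(1-u) du / ∫_0^{α_A x} φ(u) du` for `0 < x ≤ 1`. -/
def ratio {Ω : Type*} [MeasurableSpace Ω] (P : Measure Ω) (ξ : Ω → ℝ) (μ : Measure ℝ)
    (A : Set Ω) (x : ℝ) : ℝ :=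
  P.real Aᶜ / (∫ u in (0 : ℝ)..(P.real Aᶜ * x), spectrum μ u) *
    ∫ u in (0 : ℝ)..x, condQuantile P ξ A (1 - u)

/-- The function `r` on `[0,1]`: the quotient for `x > 0`, where the form `0/0` at `x = 0` is
replaced by the upper limit at `0⁺` (the limit `r(0⁺)` as soon as it exists). -/
def r {Ω : Type*} [MeasurableSpace Ω] (P : Measure Ω) (ξ : Ω → ℝ) (μ : Measure ℝ)
    (A : Set Ω) (x : ℝ) : EReal :=
  open Classical in
  if x = 0 then limsup (fun y : ℝ => ((ratio P ξ μ A y : ℝ) : EReal)) (𝓝[>] 0)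
  else ((ratio P ξ μ A x : ℝ) : EReal)

end SpectralRisk

end

/-! Write α = P(Aᶜ), G(y) = ∫₀^y φ (`cumSpectrum`), and let T(y) (`tailMass`) be the ξ-mass of the
upper y-tail of ξ on Aᶜ. For Y ≤ 0 vanishing on A, slicing by levels turns both functionals into
integrals over t > 0 of the probability p(t) = P(Y ≤ -t): the risk is ∫ G(p(t)) dt
(`spectralRisk_eq`), while E[-ξY] is the integral of the ξ-masses of {Y ≤ -t}, hence at most ∫
T(p(t)) dt. A bound T ≤ N·G on (0, α] therefore gives E[ξY] ≥ -ρ₀N (`le_integral_of_mem_feasible`).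

Conversely, the positions -c·1_B, with B an upper level set of ξ in Aᶜ and c exhausting the risk
budget, show that a lower bound D of E[ξY] forces T ≤ (-D/ρ₀)·G at y = P(B). Atoms of ξ leave gaps
between such y; there T is affine and G concave, so the inequality extends to the whole gap
(`tailMass_le`).

Since r(x) = T(αx)/G(αx), this gives Δ(A) = -ρ₀ sup r over (0,1], finite exactly when r is bounded.
Continuity of r on (0,1] places the supremum either at a point there or in the upper limit at 0. For
(i), r can blow up only at 0, where integrating a comparison of quantile and φ decides; the
arguments x and αx are reconciled by αG(x) ≤ G(αx) ≤ G(x). -/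

namespace SpectralRisk

/-! ### Generalized inverses of distribution functions -/

section Quantile

variable {Ω : Type*} [MeasurableSpace Ω] {P : Measure Ω} {X : Ω → ℝ}

/-- Right continuity of the distribution function makes the infimum attained; 0 < u < 1 makes its
set bounded below and nonempty. -/
theorem quantile_le_iff (P : Measure Ω) (X : Ω → ℝ) {u x : ℝ} (hu : u ∈ Ioo (0 : ℝ) 1) :
    quantile P X u ≤ x ↔ u ≤ cdf (P.map X) x := by
  have hbdd : BddBelow {x : ℝ | u ≤ cdf (P.map X) x} := by
    obtain ⟨b, hb⟩ := ((tendsto_cdf_atBot (P.map X)).eventually_lt_const hu.1).exists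
    refine ⟨b, fun y hy => ?_⟩
    by_contra! h
    exact absurd (hy.trans (monotone_cdf _ h.le)) (not_le.2 hb)
  have hne : {x : ℝ | u ≤ cdf (P.map X) x}.Nonempty := by
    obtain ⟨b, hb⟩ := ((tendsto_cdf_atTop (P.map X)).eventually_const_lt hu.2).exists
    exact ⟨b, hb.le⟩
  refine ⟨fun h => ?_, fun h => csInf_le hbdd h⟩
  refine le_trans ?_ (monotone_cdf _ h)
  have hcont : Tendsto (cdf (P.map X)) (𝓝[>] (quantile P X u))
      (𝓝 (cdf (P.map X) (quantile P X u))) :=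
    ((cdf (P.map X)).right_continuous _).mono Ioi_subset_Ici_self
  refine ge_of_tendsto hcont ?_
  filter_upwards [self_mem_nhdsWithin] with y hy
  obtain ⟨z, hz, hzy⟩ := exists_lt_of_csInf_lt hne hy
  exact le_trans hz (monotone_cdf _ hzy.le)

theorem monotoneOn_quantile (P : Measure Ω) (X : Ω → ℝ) :
    MonotoneOn (quantile P X) (Ioo 0 1) := fun _ hu _ hv huv =>
  (quantile_le_iff P X hu).2 (huv.trans ((quantile_le_iff P X hv).1 le_rfl))

theorem cdf_map_eq [IsProbabilityMeasure P] (hX : AEMeasurable X P) (x : ℝ) :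
    cdf (P.map X) x = P.real {ω | X ω ≤ x} := by
  have := Measure.isProbabilityMeasure_map hX
  rw [cdf_eq_real, measureReal_def, measureReal_def, Measure.map_apply_of_aemeasurable hX
    measurableSet_Iic]
  rfl

end Quantile

/-- Without a negative part the two branches of `extIntegral` agree, the value +∞ included. -/
theorem extIntegral_of_nonneg {α : Type*} [MeasurableSpace α] {ν : Measure α} {f : α → EReal}
    (hf : ∀ᵐ a ∂ν, 0 ≤ f a) :
    extIntegral ν f = ((∫⁻ a, (f a).toENNReal ∂ν : ENNReal) : EReal) := by
  have h0 : ∫⁻ a, (-f a).toENNReal ∂ν = 0 := by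
    rw [← lintegral_zero (μ := ν)]
    refine lintegral_congr_ae ?_
    filter_upwards [hf] with a ha
    exact EReal.toENNReal_of_nonpos (by simpa using ha)
  unfold extIntegral
  split_ifs with h
  · rw [h]; rfl
  · rw [h0]; simp

/-- The integrated spectrum `∫₀^y φ`, written as the `μ`-average of `min (1, y / β)`. -/
noncomputable def cumSpectrum (μ : Measure ℝ) (y : ℝ) : ENNReal :=
  ∫⁻ β, ENNReal.ofReal β⁻¹ * ENNReal.ofReal (min β y) ∂μ

/-! ### The risk of a nonpositive position as an integral over levels -/

section Risk

variable {Ω : Type*} [MeasurableSpace Ω] {P : Measure Ω} [IsProbabilityMeasure P] {μ : Measure ℝ}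

theorem volume_Ioo_inter_Iic {b p : ℝ} :
    volume ({u : ℝ | u ≤ p} ∩ Ioo 0 b) = ENNReal.ofReal (min b p) := by
  rcases lt_or_ge p b with h | h
  · rw [show {u : ℝ | u ≤ p} ∩ Ioo 0 b = Ioc 0 p by
      ext u; simp only [mem_inter_iff, mem_ofPred_eq, mem_Ioo, mem_Ioc]; grind]
    rw [Real.volume_Ioc, min_eq_right h.le, sub_zero]
  · rw [show {u : ℝ | u ≤ p} ∩ Ioo 0 b = Ioo 0 b by
      ext u; simp only [mem_inter_iff, mem_ofPred_eq, mem_Ioo]; grind]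
    rw [Real.volume_Ioo, min_eq_left h, sub_zero]

theorem VaR_nonneg {Y : Ω → ℝ} (hY : AEMeasurable Y P) (hY0 : ∀ᵐ ω ∂P, Y ω ≤ 0) {u : ℝ}
    (hu : u ∈ Ioo (0 : ℝ) 1) : 0 ≤ VaR P u Y := by
  rw [VaR, neg_nonneg, quantile_le_iff P Y hu, cdf_map_eq hY]
  have : P {ω | Y ω ≤ 0} = 1 := by
    rw [measure_congr (eventuallyEq_univ.2 hY0), measure_univ]
  rw [measureReal_def, this]
  simpa using hu.2.le

/-- Layer cake: VaR_u ≥ t holds exactly for u ≤ P(Y ≤ -t), which cuts an interval out of (0, β). -/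
theorem lintegral_VaR {Y : Ω → ℝ} (hY : AEMeasurable Y P) (hY0 : ∀ᵐ ω ∂P, Y ω ≤ 0) {β : ℝ}
    (hβ : β ≤ 1) :
    ∫⁻ u in Ioo 0 β, ENNReal.ofReal (VaR P u Y) =
      ∫⁻ t in Ioi (0 : ℝ), ENNReal.ofReal (min β (P.real {ω | Y ω ≤ -t})) := by
  have hsub : Ioo 0 β ⊆ Ioo (0 : ℝ) 1 := Ioo_subset_Ioo_right hβ
  rw [lintegral_eq_lintegral_meas_le]
  · refine lintegral_congr fun t => ?_
    rw [Measure.restrict_apply' measurableSet_Ioo, ← volume_Ioo_inter_Iic]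
    congr 1
    ext u
    simp only [mem_inter_iff, mem_ofPred_eq, and_congr_left_iff]
    intro hu
    rw [VaR, le_neg, quantile_le_iff P Y (hsub hu), cdf_map_eq hY]
  · filter_upwards [ae_restrict_mem measurableSet_Ioo] with u hu
    exact VaR_nonneg hY hY0 (hsub hu)
  · refine aemeasurable_restrict_of_antitoneOn measurableSet_Ioo fun u hu v hv huv => ?_
    exact neg_le_neg (monotoneOn_quantile P Y (hsub hu) (hsub hv) huv)

/-- Tonelli exchanges the average over β with the integral over levels t; the inner β-integral is
then `cumSpectrum`. -/
theorem spectralRisk_eq [SFinite μ] (hμ : ∀ᵐ β ∂μ, β ∈ Ioc (0 : ℝ) 1) {Y : Ω → ℝ}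
    (hY : AEMeasurable Y P) (hY0 : ∀ᵐ ω ∂P, Y ω ≤ 0) :
    spectralRisk P μ Y =
      ((∫⁻ t in Ioi (0 : ℝ), cumSpectrum μ (P.real {ω | Y ω ≤ -t}) : ENNReal) : EReal) := by
  have hC : ∀ β ∈ Ioc (0 : ℝ) 1, CVaR P β Y = ((β⁻¹ : ℝ) : EReal) *
      ((∫⁻ t in Ioi (0 : ℝ), ENNReal.ofReal (min β (P.real {ω | Y ω ≤ -t})) : ENNReal) :
        EReal) := by
    intro β hβ
    rw [CVaR, extIntegral_of_nonneg, ← lintegral_VaR hY hY0 hβ.2]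
    · simp
    · filter_upwards [ae_restrict_mem measurableSet_Ioo] with u hu
      exact_mod_cast VaR_nonneg hY hY0 (Ioo_subset_Ioo_right hβ.2 hu)
  rw [spectralRisk, extIntegral_of_nonneg]
  · congr 1
    have hmono : Antitone fun t : ℝ => P.real {ω | Y ω ≤ -t} := fun s t hst =>
      measureReal_mono fun ω (hω : Y ω ≤ -t) => show Y ω ≤ -s by linarith
    have hmeas : Measurable fun t : ℝ => P.real {ω | Y ω ≤ -t} := hmono.measurable
    unfold cumSpectrum
    rw [← lintegral_lintegral_swap]
    · refine lintegral_congr_ae ?_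
      filter_upwards [hμ] with β hβ
      rw [hC β hβ, EReal.toENNReal_mul (by exact_mod_cast (inv_pos.2 hβ.1).le),
        EReal.toENNReal_coe, lintegral_const_mul]
      · simp
      · fun_prop
    · refine Measurable.aemeasurable ?_
      have : Measurable fun a : ℝ × ℝ => P.real {ω | Y ω ≤ -a.2} := hmeas.comp measurable_snd
      unfold Function.uncurry
      exact (by fun_prop : Measurable fun a : ℝ × ℝ => ENNReal.ofReal a.1⁻¹).mul
        (measurable_fst.min this).ennreal_ofReal
  · filter_upwards [hμ] with β hβ
    rw [hC β hβ]
    exact mul_nonneg (by exact_mod_cast (inv_pos.2 hβ.1).le) (EReal.coe_ennreal_nonneg _)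

end Risk

/-! ### The integrated spectrum: bounds, concavity, link with φ -/

section CumSpectrum

variable {μ : Measure ℝ}

theorem cumSpectrum_le_one [IsProbabilityMeasure μ] (hμ : ∀ᵐ β ∂μ, β ∈ Ioc (0 : ℝ) 1) (y : ℝ) :
    cumSpectrum μ y ≤ 1 := by
  calc cumSpectrum μ y ≤ ∫⁻ _, 1 ∂μ := by
        refine lintegral_mono_ae ?_
        filter_upwards [hμ] with β hβ
        rw [← ENNReal.ofReal_mul (inv_pos.2 hβ.1).le, ENNReal.ofReal_le_one]
        calc β⁻¹ * min β y ≤ β⁻¹ * β := by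
              have := (inv_pos.2 hβ.1).le
              gcongr
              exact min_le_left _ _
          _ = 1 := inv_mul_cancel₀ hβ.1.ne'
    _ = 1 := by simp

theorem cumSpectrum_zero : cumSpectrum μ 0 = 0 := by
  unfold cumSpectrum
  rw [← lintegral_zero (μ := μ)]
  refine lintegral_congr fun β => ?_
  rw [ENNReal.ofReal_of_nonpos (min_le_right β 0), mul_zero]

theorem cumSpectrum_pos [IsProbabilityMeasure μ] (hμ : ∀ᵐ β ∂μ, β ∈ Ioc (0 : ℝ) 1) {y : ℝ}
    (hy : 0 < y) : cumSpectrum μ y ≠ 0 := by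
  unfold cumSpectrum
  intro h
  rw [lintegral_eq_zero_iff (by fun_prop)] at h
  have : ∀ᵐ β ∂μ, False := by
    filter_upwards [hμ, h] with β hβ h0
    have h1 : 0 < β⁻¹ := inv_pos.2 hβ.1
    have h2 : 0 < min β y := lt_min hβ.1 hy
    simp only [Pi.zero_apply, mul_eq_zero, ENNReal.ofReal_eq_zero] at h0
    rcases h0 with h0 | h0 <;> linarith
  simp at this
  exact IsProbabilityMeasure.ne_zero μ this

theorem cumSpectrum_toReal [IsProbabilityMeasure μ] (hμ : ∀ᵐ β ∂μ, β ∈ Ioc (0 : ℝ) 1) {y : ℝ}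
    (hy : 0 ≤ y) : (cumSpectrum μ y).toReal = ∫ β, β⁻¹ * min β y ∂μ := by
  rw [integral_eq_lintegral_of_nonneg_ae]
  · congr 1
    refine lintegral_congr_ae ?_
    filter_upwards [hμ] with β hβ
    rw [← ENNReal.ofReal_mul (inv_pos.2 hβ.1).le]
  · filter_upwards [hμ] with β hβ
    exact mul_nonneg (inv_pos.2 hβ.1).le (le_min hβ.1.le hy)
  · exact Measurable.aestronglyMeasurable (by fun_prop)

theorem integrable_inv_mul_min [IsProbabilityMeasure μ] (hμ : ∀ᵐ β ∂μ, β ∈ Ioc (0 : ℝ) 1) {y : ℝ}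
    (hy : 0 ≤ y) : Integrable (fun β => β⁻¹ * min β y) μ := by
  refine Integrable.of_bound (Measurable.aestronglyMeasurable (by fun_prop)) 1 ?_
  filter_upwards [hμ] with β hβ
  rw [Real.norm_of_nonneg (mul_nonneg (inv_pos.2 hβ.1).le (le_min hβ.1.le hy))]
  calc β⁻¹ * min β y ≤ β⁻¹ * β := by
        have := (inv_pos.2 hβ.1).le
        gcongr
        exact min_le_left _ _
    _ = 1 := inv_mul_cancel₀ hβ.1.ne'

/-- An average of the concave functions y ↦ min(β, y)/β. -/
theorem concaveOn_cumSpectrum [IsProbabilityMeasure μ] (hμ : ∀ᵐ β ∂μ, β ∈ Ioc (0 : ℝ) 1) :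
    ConcaveOn ℝ (Ici 0) fun y => (cumSpectrum μ y).toReal := by
  refine ⟨convex_Ici 0, fun x hx y hy a b ha hb hab => ?_⟩
  have hz : 0 ≤ a • x + b • y := add_nonneg (mul_nonneg ha hx) (mul_nonneg hb hy)
  simp only
  rw [cumSpectrum_toReal hμ hx, cumSpectrum_toReal hμ hy, cumSpectrum_toReal hμ hz,
    smul_eq_mul, smul_eq_mul, ← integral_const_mul, ← integral_const_mul, ← integral_add
      ((integrable_inv_mul_min hμ hx).const_mul a) ((integrable_inv_mul_min hμ hy).const_mul b)]
  refine integral_mono_ae (((integrable_inv_mul_min hμ hx).const_mul a).add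
    ((integrable_inv_mul_min hμ hy).const_mul b)) (integrable_inv_mul_min hμ hz) ?_
  filter_upwards [hμ] with β hβ
  have h1 : a * min β x + b * min β y ≤ min β (a • x + b • y) := by
    refine le_min ?_ ?_
    · calc a * min β x + b * min β y ≤ a * β + b * β := by
            gcongr <;> exact min_le_left _ _
        _ = β := by rw [← add_mul, hab, one_mul]
    · simp only [smul_eq_mul]
      gcongr <;> exact min_le_right _ _
  calc a * (β⁻¹ * min β x) + b * (β⁻¹ * min β y) = β⁻¹ * (a * min β x + b * min β y) := by ring
    _ ≤ _ := mul_le_mul_of_nonneg_left h1 (inv_pos.2 hβ.1).le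

theorem monotone_cumSpectrum (μ : Measure ℝ) : Monotone (cumSpectrum μ) := fun x y h => by
  unfold cumSpectrum
  gcongr

theorem ofReal_spectrum [IsProbabilityMeasure μ] {u : ℝ} (hu : 0 < u) :
    ENNReal.ofReal (spectrum μ u) = ∫⁻ s in Ioc u 1, ENNReal.ofReal s⁻¹ ∂μ := by
  refine ofReal_integral_eq_lintegral_ofReal ?_ ?_
  · refine Integrable.of_bound (Measurable.aestronglyMeasurable (by fun_prop)) u⁻¹ ?_
    filter_upwards [ae_restrict_mem measurableSet_Ioc] with s hs
    have := hu.trans hs.1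
    rw [Real.norm_of_nonneg (by positivity)]
    exact inv_anti₀ hu hs.1.le
  · filter_upwards [ae_restrict_mem measurableSet_Ioc] with s hs
    exact inv_nonneg.2 (hu.trans hs.1).le

theorem spectrum_nonneg (μ : Measure ℝ) {u : ℝ} (hu : 0 ≤ u) : 0 ≤ spectrum μ u :=
  setIntegral_nonneg measurableSet_Ioc fun _ hs => inv_nonneg.2 (hu.trans hs.1.le)

theorem antitoneOn_spectrum [IsProbabilityMeasure μ] : AntitoneOn (spectrum μ) (Ioi 0) := by
  intro u hu v hv huv
  rw [← ENNReal.ofReal_le_ofReal_iff (spectrum_nonneg μ (le_of_lt hu)), ofReal_spectrum hu,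
    ofReal_spectrum hv]
  exact lintegral_mono_set (Ioc_subset_Ioc_left huv)

/-- Tonelli on the region u < s: each s contributes 1/s times the length min(s, y). -/
theorem lintegral_spectrum [IsProbabilityMeasure μ] (hμ : ∀ᵐ β ∂μ, β ∈ Ioc (0 : ℝ) 1) (y : ℝ) :
    ∫⁻ u in Ioc 0 y, ENNReal.ofReal (spectrum μ u) = cumSpectrum μ y := by
  calc ∫⁻ u in Ioc 0 y, ENNReal.ofReal (spectrum μ u)
      = ∫⁻ u in Ioc 0 y, ∫⁻ s, {p : ℝ × ℝ | p.1 < p.2}.indicator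
          (fun p => ENNReal.ofReal p.2⁻¹) (u, s) ∂μ := by
        refine setLIntegral_congr_fun measurableSet_Ioc fun u hu => ?_
        rw [ofReal_spectrum hu.1, ← lintegral_indicator measurableSet_Ioc]
        refine lintegral_congr_ae ?_
        filter_upwards [hμ] with s hs
        simp [indicator, hs.2]
    _ = ∫⁻ s, (∫⁻ u in Ioc 0 y, {p : ℝ × ℝ | p.1 < p.2}.indicator
          (fun p => ENNReal.ofReal p.2⁻¹) (u, s)) ∂μ := by
        refine lintegral_lintegral_swap (Measurable.aemeasurable ?_)
        exact Measurable.indicator (by fun_prop) (measurableSet_lt measurable_fst measurable_snd)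
    _ = cumSpectrum μ y := by
        refine lintegral_congr fun s => ?_
        have : ∀ u : ℝ, {p : ℝ × ℝ | p.1 < p.2}.indicator (fun p => ENNReal.ofReal p.2⁻¹) (u, s)
            = (Iio s).indicator (fun _ => ENNReal.ofReal s⁻¹) u := fun u => by
          simp [indicator]
        simp_rw [this]
        rw [lintegral_indicator measurableSet_Iio, setLIntegral_const,
          Measure.restrict_apply measurableSet_Iio]
        congr 1
        rw [measure_congr (Iio_ae_eq_Iic.inter (ae_eq_refl (Ioc 0 y))), inter_comm,
          Ioc_inter_Iic, Real.volume_Ioc, sub_zero, min_comm]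

theorem integrableOn_spectrum [IsProbabilityMeasure μ] (hμ : ∀ᵐ β ∂μ, β ∈ Ioc (0 : ℝ) 1) (y : ℝ) :
    IntegrableOn (spectrum μ) (Ioc 0 y) := by
  have hae : AEMeasurable (spectrum μ) (volume.restrict (Ioc 0 y)) :=
    aemeasurable_restrict_of_antitoneOn measurableSet_Ioc
      (antitoneOn_spectrum.mono Ioc_subset_Ioi_self)
  refine ⟨hae.aestronglyMeasurable, ?_⟩
  rw [hasFiniteIntegral_iff_ofReal]
  · rw [lintegral_spectrum hμ]
    exact (cumSpectrum_le_one hμ y).trans_lt ENNReal.one_lt_top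
  · filter_upwards [ae_restrict_mem measurableSet_Ioc] with u hu
    exact spectrum_nonneg μ hu.1.le

theorem integral_spectrum [IsProbabilityMeasure μ] (hμ : ∀ᵐ β ∂μ, β ∈ Ioc (0 : ℝ) 1) {y : ℝ}
    (hy : 0 ≤ y) : ∫ u in (0 : ℝ)..y, spectrum μ u = (cumSpectrum μ y).toReal := by
  rw [intervalIntegral.integral_of_le hy, integral_eq_lintegral_of_nonneg_ae,
    lintegral_spectrum hμ]
  · filter_upwards [ae_restrict_mem measurableSet_Ioc] with u hu
    exact spectrum_nonneg μ hu.1.le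
  · exact (integrableOn_spectrum hμ y).1

end CumSpectrum

/-- The largest mass `∫_B ξ dP` that a part `B` of `Aᶜ` of probability `y` can carry,
in layer-cake form. -/
noncomputable def tailMass {Ω : Type*} [MeasurableSpace Ω] (P : Measure Ω) (ξ : Ω → ℝ) (A : Set Ω)
    (y : ℝ) : ENNReal :=
  ∫⁻ s in Ioi (0 : ℝ), min (ENNReal.ofReal y) (P (Aᶜ ∩ {ω | s < ξ ω}))

/-! ### Extremality of upper level sets -/

section TailMass

variable {Ω : Type*} [MeasurableSpace Ω] {P : Measure Ω} {ξ : Ω → ℝ}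
  {A : Set Ω}

theorem tailMass_zero : tailMass P ξ A 0 = 0 := by
  unfold tailMass
  simp

theorem tailMass_mono {y z : ℝ} (h : y ≤ z) : tailMass P ξ A y ≤ tailMass P ξ A z :=
  lintegral_mono fun _ => min_le_min_right _ (ENNReal.ofReal_le_ofReal h)

theorem setLIntegral_eq_layercake (hξ : Measurable ξ) (hξ0 : ∀ᵐ ω ∂P, 0 ≤ ξ ω) (B : Set Ω) :
    ∫⁻ ω in B, ENNReal.ofReal (ξ ω) ∂P = ∫⁻ s in Ioi (0 : ℝ), P (B ∩ {ω | s < ξ ω}) := by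
  rw [lintegral_eq_lintegral_meas_lt _ (ae_restrict_of_ae hξ0) hξ.aemeasurable]
  refine lintegral_congr fun s => ?_
  rw [Measure.restrict_apply (measurableSet_lt measurable_const hξ), inter_comm]

/-- Layer by layer, B ∩ {ξ > s} is no larger than B and no larger than Aᶜ ∩ {ξ > s}. -/
theorem setLIntegral_le_tailMass [IsProbabilityMeasure P]
    (hξ : Measurable ξ) (hξ0 : ∀ᵐ ω ∂P, 0 ≤ ξ ω) {B : Set Ω}
    (hB : B ≤ᵐ[P] Aᶜ) :
    ∫⁻ ω in B, ENNReal.ofReal (ξ ω) ∂P ≤ tailMass P ξ A (P.real B) := by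
  rw [setLIntegral_eq_layercake hξ hξ0]
  refine lintegral_mono fun s => le_min ?_ ?_
  · rw [ofReal_measureReal]
    exact measure_mono inter_subset_left
  · exact measure_mono_ae (hB.inter (EventuallyLE.refl _ _))

/-- Condition `hn` makes B comparable with every layer Aᶜ ∩ {ξ > s}, as upper level sets are, so the
smaller of the two bounds is attained at each s. -/
theorem setLIntegral_eq_tailMass [IsProbabilityMeasure P]
    (hξ : Measurable ξ) (hξ0 : ∀ᵐ ω ∂P, 0 ≤ ξ ω) {B : Set Ω}
    (hB : B ⊆ Aᶜ) (hn : ∀ s, B ⊆ {ω | s < ξ ω} ∨ Aᶜ ∩ {ω | s < ξ ω} ⊆ B) :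
    ∫⁻ ω in B, ENNReal.ofReal (ξ ω) ∂P = tailMass P ξ A (P.real B) := by
  refine le_antisymm (setLIntegral_le_tailMass hξ hξ0 (Eventually.of_forall hB)) ?_
  rw [setLIntegral_eq_layercake hξ hξ0]
  refine lintegral_mono fun s => ?_
  rcases hn s with h | h
  · simp only [inter_eq_left.2 h]
    exact (min_le_left _ _).trans (ofReal_measureReal (μ := P)).le
  · exact (min_le_right _ _).trans (measure_mono (subset_inter h inter_subset_right))

theorem tailMass_lt_top (hξ : Measurable ξ) (hξ0 : ∀ᵐ ω ∂P, 0 ≤ ξ ω) (hi : Integrable ξ P)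
    (y : ℝ) : tailMass P ξ A y < ⊤ := by
  calc tailMass P ξ A y ≤ ∫⁻ s in Ioi (0 : ℝ), P (Aᶜ ∩ {ω | s < ξ ω}) :=
        lintegral_mono fun s => min_le_right _ _
    _ = ∫⁻ ω in Aᶜ, ENNReal.ofReal (ξ ω) ∂P := (setLIntegral_eq_layercake hξ hξ0 _).symm
    _ ≤ ∫⁻ ω, ENNReal.ofReal (ξ ω) ∂P := setLIntegral_le_lintegral _ _
    _ < ⊤ := (hasFiniteIntegral_iff_ofReal hξ0).1 hi.2

/-- `tailMass` is affine across an atom of the conditional law of `ξ`. -/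
theorem tailMass_affine [IsProbabilityMeasure P] {c : ℝ} (hc : 0 ≤ c) {y : ℝ}
    (h1 : P.real (Aᶜ ∩ {ω | c < ξ ω}) ≤ y) (h2 : y ≤ P.real (Aᶜ ∩ {ω | c ≤ ξ ω})) :
    tailMass P ξ A y =
      ENNReal.ofReal (c * y) + ∫⁻ s in Ici c, P (Aᶜ ∩ {ω | s < ξ ω}) := by
  rw [tailMass, setLIntegral_congr Ioi_ae_eq_Ici, ← Ico_union_Ici_eq_Ici hc,
    lintegral_union measurableSet_Ici (by
      rw [Set.disjoint_left]; exact fun s hs hs' => absurd hs.2 (not_lt.2 hs'))]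
  -- Below c the minimum is y; from c on it is the probability of the layer, independent of y.
  congr 1
  · rw [setLIntegral_congr_fun (g := fun _ => ENNReal.ofReal y) measurableSet_Ico,
      setLIntegral_const, Real.volume_Ico, sub_zero, mul_comm, ENNReal.ofReal_mul hc]
    intro s hs
    refine min_eq_left ?_
    calc ENNReal.ofReal y ≤ P (Aᶜ ∩ {ω | c ≤ ξ ω}) := by
          rw [← ofReal_measureReal (μ := P)]
          exact ENNReal.ofReal_le_ofReal h2
      _ ≤ _ := measure_mono (inter_subset_inter_right _ fun ω hω => lt_of_lt_of_le hs.2 hω)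
  · refine setLIntegral_congr_fun measurableSet_Ici fun s hs => min_eq_right ?_
    calc P (Aᶜ ∩ {ω | s < ξ ω}) ≤ P (Aᶜ ∩ {ω | c < ξ ω}) :=
          measure_mono (inter_subset_inter_right _ fun ω (hω : s < ξ ω) => lt_of_le_of_lt hs hω)
      _ ≤ ENNReal.ofReal y := by
          rw [← ofReal_measureReal (μ := P)]
          exact ENNReal.ofReal_le_ofReal h1

end TailMass

/-! ### Upper quantiles and their layer-cake integral -/

section UpperQuantile

variable {Ω : Type*} [MeasurableSpace Ω] {Q : Measure Ω} {ξ : Ω → ℝ}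

theorem volume_Iio_inter_Ioo {b p : ℝ} :
    volume ({u : ℝ | u < p} ∩ Ioo 0 b) = ENNReal.ofReal (min b p) := by
  rw [show {u : ℝ | u < p} ∩ Ioo 0 b = Ioo 0 (min b p) by
    ext u; simp only [mem_inter_iff, mem_ofPred_eq, mem_Ioo, lt_min_iff]; tauto]
  rw [Real.volume_Ioo, sub_zero]

theorem one_sub_cdf_map [IsProbabilityMeasure Q] (hξ : Measurable ξ) (s : ℝ) :
    1 - cdf (Q.map ξ) s = Q.real {ω | s < ξ ω} := by
  rw [cdf_map_eq hξ.aemeasurable, ← probReal_compl_eq_one_sub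
    (measurableSet_le hξ measurable_const)]
  congr 1
  ext ω
  simp

theorem one_sub_mem_Ioo {u : ℝ} (hu : u ∈ Ioo (0 : ℝ) 1) : 1 - u ∈ Ioo (0 : ℝ) 1 :=
  ⟨by linarith [hu.2], by linarith [hu.1]⟩

theorem lt_quantile_one_sub_iff [IsProbabilityMeasure Q]
    (hξ : Measurable ξ) {u s : ℝ} (hu : u ∈ Ioo (0 : ℝ) 1) :
    s < quantile Q ξ (1 - u) ↔ u < Q.real {ω | s < ξ ω} := by
  rw [← one_sub_cdf_map hξ, ← not_le, quantile_le_iff Q ξ (one_sub_mem_Ioo hu), not_le]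
  constructor <;> intro h <;> linarith

theorem quantile_nonneg [IsProbabilityMeasure Q]
    (hξ : Measurable ξ) (hξ0 : ∀ᵐ ω ∂Q, 0 ≤ ξ ω) {u : ℝ}
    (hu : u ∈ Ioo (0 : ℝ) 1) : 0 ≤ quantile Q ξ (1 - u) := by
  refine le_of_forall_lt fun s hs => ?_
  rw [lt_quantile_one_sub_iff hξ hu]
  have : Q {ω | s < ξ ω} = 1 := by
    rw [measure_congr (eventuallyEq_univ.2 (hξ0.mono fun ω hω => lt_of_lt_of_le hs hω)),
      measure_univ]
  rw [measureReal_def, this]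
  exact hu.2

theorem antitoneOn_quantile_one_sub : AntitoneOn (fun u => quantile Q ξ (1 - u)) (Ioo 0 1) :=
  fun _ hu _ hv huv => monotoneOn_quantile Q ξ (one_sub_mem_Ioo hv) (one_sub_mem_Ioo hu)
    (by linarith)

/-- Every s strictly below the quantile satisfies u < Q(ξ > s); let s increase to it, using
continuity from above. -/
theorem le_measureReal_quantile_le [IsProbabilityMeasure Q]
    (hξ : Measurable ξ) {u : ℝ} (hu : u ∈ Ioo (0 : ℝ) 1) :
    u ≤ Q.real {ω | quantile Q ξ (1 - u) ≤ ξ ω} := by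
  set c := quantile Q ξ (1 - u)
  have hlim : Tendsto (fun n : ℕ => Q.real {ω | c - 1 / ((n : ℝ) + 1) < ξ ω}) atTop
      (𝓝 (Q.real {ω | c ≤ ξ ω})) := by
    have hset : {ω | c ≤ ξ ω} = ⋂ n : ℕ, {ω | c - 1 / ((n : ℝ) + 1) < ξ ω} := by
      ext ω
      simp only [mem_ofPred_eq, mem_iInter]
      refine ⟨fun h n => ?_, fun h => ?_⟩
      · have : 0 < 1 / ((n : ℝ) + 1) := by positivity
        linarith
      · refine le_of_tendsto' (f := fun n : ℕ => c - 1 / ((n : ℝ) + 1)) (x := atTop) ?_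
          fun n => (h n).le
        simpa using tendsto_const_nhds.sub (tendsto_one_div_add_atTop_nhds_zero_nat (𝕜 := ℝ))
    rw [hset]
    refine (ENNReal.tendsto_toReal (measure_ne_top _ _)).comp
      (tendsto_measure_iInter_atTop
        (fun n => (measurableSet_lt measurable_const hξ).nullMeasurableSet) ?_
        ⟨0, measure_ne_top _ _⟩)
    intro m n hmn ω (hω : c - 1 / ((n : ℝ) + 1) < ξ ω)
    have := Nat.one_div_le_one_div (α := ℝ) hmn
    show c - 1 / ((m : ℝ) + 1) < ξ ω
    linarith
  refine ge_of_tendsto' hlim fun n => ((lt_quantile_one_sub_iff hξ hu).1 ?_).le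
  have : 0 < 1 / ((n : ℝ) + 1) := by positivity
  linarith

theorem lintegral_quantile_one_sub [IsProbabilityMeasure Q]
    (hξ : Measurable ξ) (hξ0 : ∀ᵐ ω ∂Q, 0 ≤ ξ ω) {x : ℝ}
    (hx : x ≤ 1) :
    ∫⁻ u in Ioo 0 x, ENNReal.ofReal (quantile Q ξ (1 - u)) =
      ∫⁻ s in Ioi (0 : ℝ), min (ENNReal.ofReal x) (Q {ω | s < ξ ω}) := by
  have hsub : Ioo 0 x ⊆ Ioo (0 : ℝ) 1 := Ioo_subset_Ioo_right hx
  rw [lintegral_eq_lintegral_meas_lt]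
  · refine lintegral_congr fun s => ?_
    rw [Measure.restrict_apply' measurableSet_Ioo, ← ofReal_measureReal (μ := Q),
      ← ENNReal.ofReal_min, ← volume_Iio_inter_Ioo]
    congr 1
    ext u
    simp only [mem_inter_iff, mem_ofPred_eq, and_congr_left_iff]
    exact fun hu => lt_quantile_one_sub_iff hξ (hsub hu)
  · filter_upwards [ae_restrict_mem measurableSet_Ioo] with u hu
    exact quantile_nonneg hξ hξ0 (hsub hu)
  · exact aemeasurable_restrict_of_antitoneOn measurableSet_Ioo
      (antitoneOn_quantile_one_sub.mono hsub)

end UpperQuantile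

/-! ### Conditional quantiles given Aᶜ in terms of `tailMass` -/

section CondQuantile

variable {Ω : Type*} [MeasurableSpace Ω] {P : Measure Ω} {ξ : Ω → ℝ}
  {A : Set Ω}

theorem measureReal_compl_pos [IsProbabilityMeasure P]
    (hA : MeasurableSet A) (hPA : P A < 1) : 0 < P.real Aᶜ := by
  rw [probReal_compl_eq_one_sub hA, measureReal_def]
  have := (ENNReal.toReal_lt_toReal hPA.ne_top ENNReal.one_ne_top).2 hPA
  rw [ENNReal.toReal_one] at this
  linarith

theorem measure_compl_ne_zero [IsProbabilityMeasure P]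
    (hA : MeasurableSet A) (hPA : P A < 1) : P Aᶜ ≠ 0 := fun h => by
  have := measureReal_compl_pos hA hPA
  rw [measureReal_def, h] at this
  simp at this

theorem ae_cond_nonneg (hξ0 : ∀ᵐ ω ∂P, 0 ≤ ξ ω) : ∀ᵐ ω ∂(cond P Aᶜ), 0 ≤ ξ ω :=
  (cond_absolutelyContinuous (μ := P) (s := Aᶜ)).ae_le hξ0

theorem lintegral_condQuantile [IsProbabilityMeasure P] (hξ : Measurable ξ) (hξ0 : ∀ᵐ ω ∂P, 0 ≤ ξ ω)
    (hA : MeasurableSet A) (hPA : P A < 1) {x : ℝ} (hx : x ≤ 1) :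
    P Aᶜ * ∫⁻ u in Ioo 0 x, ENNReal.ofReal (condQuantile P ξ A (1 - u)) =
      tailMass P ξ A (P.real Aᶜ * x) := by
  have hne := measure_compl_ne_zero hA hPA
  have := cond_isProbabilityMeasure hne
  unfold condQuantile tailMass
  rw [lintegral_quantile_one_sub hξ (ae_cond_nonneg hξ0) hx, ← lintegral_const_mul' _ _
    (measure_ne_top P _)]
  refine lintegral_congr fun s => ?_
  rw [cond_apply hA.compl, mul_min, ← mul_assoc, ENNReal.mul_inv_cancel hne (measure_ne_top _ _),
    one_mul, ENNReal.ofReal_mul measureReal_nonneg, ofReal_measureReal]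

theorem integrableOn_condQuantile [IsProbabilityMeasure P]
    (hξ : Measurable ξ) (hξ0 : ∀ᵐ ω ∂P, 0 ≤ ξ ω)
    (hi : Integrable ξ P) (hA : MeasurableSet A) (hPA : P A < 1) :
    IntegrableOn (fun u => condQuantile P ξ A (1 - u)) (Icc 0 1) := by
  have := cond_isProbabilityMeasure (measure_compl_ne_zero hA hPA)
  rw [integrableOn_Icc_iff_integrableOn_Ioo]
  refine ⟨(aemeasurable_restrict_of_antitoneOn measurableSet_Ioo
    antitoneOn_quantile_one_sub).aestronglyMeasurable, ?_⟩
  rw [hasFiniteIntegral_iff_ofReal]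
  · have h1 := lintegral_condQuantile hξ hξ0 hA hPA le_rfl
    have h2 := tailMass_lt_top (A := A) hξ hξ0 hi (P.real Aᶜ * 1)
    rw [← h1] at h2
    exact lt_top_iff_ne_top.2 fun h => h2.ne (by
      rw [h, ENNReal.mul_top (measure_compl_ne_zero hA hPA)])
  · filter_upwards [ae_restrict_mem measurableSet_Ioo] with u hu
    exact quantile_nonneg hξ (ae_cond_nonneg hξ0) hu

theorem integral_condQuantile [IsProbabilityMeasure P] (hξ : Measurable ξ) (hξ0 : ∀ᵐ ω ∂P, 0 ≤ ξ ω)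
    (hi : Integrable ξ P) (hA : MeasurableSet A) (hPA : P A < 1) {x : ℝ} (hx : x ∈ Icc (0 : ℝ) 1) :
    P.real Aᶜ * ∫ u in (0 : ℝ)..x, condQuantile P ξ A (1 - u) =
      (tailMass P ξ A (P.real Aᶜ * x)).toReal := by
  have := cond_isProbabilityMeasure (measure_compl_ne_zero hA hPA)
  rw [← lintegral_condQuantile hξ hξ0 hA hPA hx.2, ENNReal.toReal_mul,
    intervalIntegral.integral_of_le hx.1, integral_Ioc_eq_integral_Ioo,
    integral_eq_lintegral_of_nonneg_ae, measureReal_def]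
  · filter_upwards [ae_restrict_mem measurableSet_Ioo] with u hu
    exact quantile_nonneg hξ (ae_cond_nonneg hξ0) (Ioo_subset_Ioo_right hx.2 hu)
  · exact ((integrableOn_condQuantile hξ hξ0 hi hA hPA).mono_set
      (Ioo_subset_Icc_self.trans (Icc_subset_Icc_right hx.2))).1

theorem measureReal_inter_eq [IsProbabilityMeasure P]
    (hA : MeasurableSet A) (hPA : P A < 1) (B : Set Ω) :
    P.real (Aᶜ ∩ B) = P.real Aᶜ * (cond P Aᶜ).real B := by
  rw [measureReal_def (μ := cond P Aᶜ), cond_apply hA.compl, ENNReal.toReal_mul,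
    ENNReal.toReal_inv, ← measureReal_def, ← measureReal_def,
    mul_inv_cancel_left₀ (measureReal_compl_pos hA hPA).ne']

end CondQuantile

/-! ### Weak duality and its converse by test positions -/

section Duality

variable {Ω : Type*} [MeasurableSpace Ω] {P : Measure Ω} [IsProbabilityMeasure P] {ξ : Ω → ℝ}
  {A : Set Ω} {μ : Measure ℝ} [IsProbabilityMeasure μ] {ρ₀ : ℝ}

theorem cumSpectrum_toReal_pos (hμ : ∀ᵐ β ∂μ, β ∈ Ioc (0 : ℝ) 1) {y : ℝ} (hy : 0 < y) :
    0 < (cumSpectrum μ y).toReal :=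
  ENNReal.toReal_pos (cumSpectrum_pos hμ hy)
    ((cumSpectrum_le_one hμ y).trans_lt ENNReal.one_lt_top).ne

theorem cumSpectrum_ne_top (hμ : ∀ᵐ β ∂μ, β ∈ Ioc (0 : ℝ) 1) (y : ℝ) : cumSpectrum μ y ≠ ⊤ :=
  ((cumSpectrum_le_one hμ y).trans_lt ENNReal.one_lt_top).ne

theorem ratio_eq (hξ : Measurable ξ) (hξ0 : ∀ᵐ ω ∂P, 0 ≤ ξ ω) (hi : Integrable ξ P)
    (hμ : ∀ᵐ β ∂μ, β ∈ Ioc (0 : ℝ) 1) (hA : MeasurableSet A) (hPA : P A < 1) {x : ℝ}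
    (hx : x ∈ Icc (0 : ℝ) 1) :
    ratio P ξ μ A x =
      (tailMass P ξ A (P.real Aᶜ * x)).toReal / (cumSpectrum μ (P.real Aᶜ * x)).toReal := by
  rw [ratio, integral_spectrum hμ (mul_nonneg measureReal_nonneg hx.1),
    ← integral_condQuantile hξ hξ0 hi hA hPA hx, div_mul_eq_mul_div]

/-- Weak duality: a bound on `tailMass / cumSpectrum` bounds `E[ξ Y]` from below. -/
theorem le_integral_of_mem_feasible (hξ : Measurable ξ) (hξ0 : ∀ᵐ ω ∂P, 0 ≤ ξ ω)
    (hi : Integrable ξ P) (hμ : ∀ᵐ β ∂μ, β ∈ Ioc (0 : ℝ) 1) (hρ₀ : 0 < ρ₀) {N : ℝ} (hN0 : 0 ≤ N)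
    (hN : ∀ y ∈ Ioc 0 (P.real Aᶜ), (tailMass P ξ A y).toReal ≤ N * (cumSpectrum μ y).toReal)
    {Y : Ω → ℝ} (hY : Y ∈ feasible P ξ μ ρ₀ A) : -(ρ₀ * N) ≤ ∫ ω, ξ ω * Y ω ∂P := by
  obtain ⟨hYm, hYi, hYr, hYA, hYc⟩ := hY
  have hY0 : ∀ᵐ ω ∂P, Y ω ≤ 0 := by
    filter_upwards [hYA, hYc] with ω h1 h2
    by_cases h : ω ∈ A
    · exact (h1 h).le
    · exact h2 h
  rw [spectralRisk_eq hμ hYm hY0] at hYr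
  have hr : ∫⁻ t in Ioi (0 : ℝ), cumSpectrum μ (P.real {ω | Y ω ≤ -t}) ≤ ENNReal.ofReal ρ₀ := by
    have := EReal.toENNReal_le_toENNReal hYr
    simpa using this
  have hlev : ∀ t ∈ Ioi (0 : ℝ), tailMass P ξ A (P.real {ω | Y ω ≤ -t}) ≤
      ENNReal.ofReal N * cumSpectrum μ (P.real {ω | Y ω ≤ -t}) := by
    intro t ht
    have hsub : {ω | Y ω ≤ -t} ≤ᵐ[P] Aᶜ := by
      filter_upwards [hYA] with ω h1 h2 h3
      have h2 : Y ω ≤ -t := h2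
      have ht : 0 < t := ht
      linarith [h1 h3]
    have hle : P.real {ω | Y ω ≤ -t} ≤ P.real Aᶜ :=
      ENNReal.toReal_mono (measure_ne_top _ _) (measure_mono_ae hsub)
    rcases (measureReal_nonneg (μ := P) (s := {ω | Y ω ≤ -t})).eq_or_lt with h0 | h0
    -- The bound `hN` starts at positive y; a null level set carries no ξ-mass.
    · rw [← h0, tailMass_zero]
      exact zero_le
    · rw [← ENNReal.ofReal_toReal (tailMass_lt_top hξ hξ0 hi _).ne,
        ← ENNReal.ofReal_toReal (cumSpectrum_ne_top hμ _), ← ENNReal.ofReal_mul hN0]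
      exact ENNReal.ofReal_le_ofReal (hN _ ⟨h0, hle⟩)
  have hξae : AEMeasurable (fun ω => ENNReal.ofReal (ξ ω)) P := hξ.ennreal_ofReal.aemeasurable
  have hYn : AEMeasurable (fun ω => -Y ω) P := hYm.neg
  -- The layer cake below is taken under ξP; absolute continuity transfers a.e. measurability and
  -- the sign of Y to it.
  have hac := withDensity_absolutelyContinuous P (fun ω => ENNReal.ofReal (ξ ω))
  have key : ∫⁻ ω, ENNReal.ofReal (ξ ω * -Y ω) ∂P ≤ ENNReal.ofReal (ρ₀ * N) := by
    calc ∫⁻ ω, ENNReal.ofReal (ξ ω * -Y ω) ∂P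
        = ∫⁻ ω, ENNReal.ofReal (-Y ω) ∂(P.withDensity fun ω => ENNReal.ofReal (ξ ω)) := by
          rw [lintegral_withDensity_eq_lintegral_mul₀ hξae hYn.ennreal_ofReal]
          refine lintegral_congr_ae ?_
          filter_upwards [hξ0] with ω hω
          exact ENNReal.ofReal_mul hω
      _ = ∫⁻ t in Ioi (0 : ℝ), ∫⁻ ω in {ω | Y ω ≤ -t}, ENNReal.ofReal (ξ ω) ∂P := by
          rw [lintegral_eq_lintegral_meas_le _ _ (hYn.mono_ac hac)]
          · refine lintegral_congr fun t => ?_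
            rw [withDensity_apply']
            simp only [le_neg]
          · filter_upwards [hac.ae_le hY0] with ω hω
            simpa using hω
      _ ≤ ∫⁻ t in Ioi (0 : ℝ), ENNReal.ofReal N * cumSpectrum μ (P.real {ω | Y ω ≤ -t}) := by
          refine setLIntegral_mono' measurableSet_Ioi fun t ht =>
            (setLIntegral_le_tailMass hξ hξ0 ?_).trans (hlev t ht)
          filter_upwards [hYA] with ω h1 h2 h3
          have h2 : Y ω ≤ -t := h2
          have ht : 0 < t := ht
          linarith [h1 h3]
      _ ≤ ENNReal.ofReal (ρ₀ * N) := by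
          rw [lintegral_const_mul' _ _ ENNReal.ofReal_ne_top, ENNReal.ofReal_mul hρ₀.le, mul_comm]
          gcongr
  have hneg : ∫ ω, ξ ω * -Y ω ∂P ≤ ρ₀ * N := by
    rw [integral_eq_lintegral_of_nonneg_ae]
    · exact ENNReal.toReal_le_of_le_ofReal (by positivity) key
    · filter_upwards [hξ0, hY0] with ω h1 h2
      exact mul_nonneg h1 (neg_nonneg.2 h2)
    · simp only [mul_neg]
      exact hYi.1.neg
  simp only [mul_neg, integral_neg] at hneg
  linarith

/-- The level set {Y ≤ -t} is B for 0 < t ≤ c and empty for t > c. -/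
theorem spectralRisk_indicator (hμ : ∀ᵐ β ∂μ, β ∈ Ioc (0 : ℝ) 1) {B : Set Ω}
    (hB : MeasurableSet B) {c : ℝ} (hc : 0 ≤ c) :
    spectralRisk P μ (B.indicator fun _ => -c) =
      ((ENNReal.ofReal c * cumSpectrum μ (P.real B) : ENNReal) : EReal) := by
  rw [spectralRisk_eq hμ (measurable_const.indicator hB).aemeasurable
    (Eventually.of_forall fun ω => indicator_nonpos (fun _ _ => neg_nonpos.2 hc) ω)]
  congr 1
  calc ∫⁻ t in Ioi (0 : ℝ), cumSpectrum μ (P.real {ω | B.indicator (fun _ => -c) ω ≤ -t})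
      = ∫⁻ t in Ioi (0 : ℝ), (Ioc 0 c).indicator (fun _ => cumSpectrum μ (P.real B)) t := by
        refine setLIntegral_congr_fun measurableSet_Ioi fun t ht => ?_
        have ht : 0 < t := ht
        by_cases htc : t ≤ c
        · have : {ω | B.indicator (fun _ => -c) ω ≤ -t} = B := by
            ext ω
            by_cases h : ω ∈ B <;> simp [h, ht, htc]
          simp only [this]
          rw [indicator_of_mem (show t ∈ Ioc 0 c from ⟨ht, htc⟩)]
        · have : {ω | B.indicator (fun _ => -c) ω ≤ -t} = ∅ := by
            ext ω
            by_cases h : ω ∈ B <;> simp [h, ht, not_le.1 htc]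
          simp only [this]
          rw [indicator_of_notMem (fun h => htc h.2), measureReal_empty, cumSpectrum_zero]
    _ = ENNReal.ofReal c * cumSpectrum μ (P.real B) := by
        rw [lintegral_indicator measurableSet_Ioc, setLIntegral_const,
          Measure.restrict_apply measurableSet_Ioc,
          inter_eq_left.2 Ioc_subset_Ioi_self, Real.volume_Ioc, sub_zero, mul_comm]

theorem indicator_mem_feasible (hi : Integrable ξ P) (hμ : ∀ᵐ β ∂μ, β ∈ Ioc (0 : ℝ) 1)
    {B : Set Ω} (hB : MeasurableSet B) (hBA : B ⊆ Aᶜ) {c : ℝ} (hc : 0 ≤ c)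
    (hcρ : c * (cumSpectrum μ (P.real B)).toReal ≤ ρ₀) :
    (B.indicator fun _ => -c) ∈ feasible P ξ μ ρ₀ A := by
  have hmul : (fun ω => ξ ω * B.indicator (fun _ => -c) ω) = B.indicator fun ω => ξ ω * -c := by
    funext ω
    by_cases h : ω ∈ B <;> simp [h]
  refine ⟨(measurable_const.indicator hB).aemeasurable, ?_, ?_, ?_, ?_⟩
  · rw [hmul]
    exact (hi.mul_const _).indicator hB
  · rw [spectralRisk_indicator hμ hB hc, ← ENNReal.ofReal_toReal (cumSpectrum_ne_top hμ _),
      ← ENNReal.ofReal_mul hc, EReal.coe_ennreal_ofReal,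
      max_eq_left (mul_nonneg hc ENNReal.toReal_nonneg)]
    exact_mod_cast hcρ
  · exact Eventually.of_forall fun ω h => indicator_of_notMem (fun hb => hBA hb h) _
  · exact Eventually.of_forall fun ω _ => indicator_nonpos (fun _ _ => neg_nonpos.2 hc) ω

/-- Testing with indicators of sets on which `ξ` is largest. -/
theorem tailMass_le_of_forall_feasible (hξ : Measurable ξ) (hξ0 : ∀ᵐ ω ∂P, 0 ≤ ξ ω)
    (hi : Integrable ξ P) (hμ : ∀ᵐ β ∂μ, β ∈ Ioc (0 : ℝ) 1) (hρ₀ : 0 < ρ₀) {D : ℝ}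
    (hD : ∀ Y ∈ feasible P ξ μ ρ₀ A, D ≤ ∫ ω, ξ ω * Y ω ∂P) {B : Set Ω}
    (hB : MeasurableSet B) (hBA : B ⊆ Aᶜ)
    (hn : ∀ s, B ⊆ {ω | s < ξ ω} ∨ Aᶜ ∩ {ω | s < ξ ω} ⊆ B) :
    (tailMass P ξ A (P.real B)).toReal ≤ -D / ρ₀ * (cumSpectrum μ (P.real B)).toReal := by
  rcases (measureReal_nonneg (μ := P) (s := B)).eq_or_lt with h0 | h0
  · rw [← h0, tailMass_zero, cumSpectrum_zero]
    simp
  have hg := cumSpectrum_toReal_pos hμ h0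
  -- This height makes the risk of the test position exactly ρ₀.
  have h1 := hD _ (indicator_mem_feasible hi hμ hB hBA
    (c := ρ₀ / (cumSpectrum μ (P.real B)).toReal) (by positivity)
    (by rw [div_mul_cancel₀ _ hg.ne']))
  have hmul : ∀ c : ℝ, (fun ω => ξ ω * B.indicator (fun _ => -c) ω) =
      B.indicator fun ω => ξ ω * -c := fun c => by
    funext ω
    by_cases h : ω ∈ B <;> simp [h]
  rw [hmul, integral_indicator hB, integral_mul_const,
    integral_eq_lintegral_of_nonneg_ae (ae_restrict_of_ae hξ0) hξ.aestronglyMeasurable,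
    setLIntegral_eq_tailMass hξ hξ0 hBA hn] at h1
  rw [div_mul_eq_mul_div, le_div_iff₀ hρ₀]
  rw [mul_neg, le_neg, mul_div_assoc', div_le_iff₀ hg] at h1
  exact h1

/-- The value αx lies between the probabilities of {ξ > c} and {ξ ≥ c} in Aᶜ, c being the
conditional upper quantile. Both sets can be tested, and concavity fills the gap between them. -/
theorem tailMass_le (hξ : Measurable ξ) (hξ0 : ∀ᵐ ω ∂P, 0 ≤ ξ ω)
    (hi : Integrable ξ P) (hμ : ∀ᵐ β ∂μ, β ∈ Ioc (0 : ℝ) 1) (hρ₀ : 0 < ρ₀)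
    (hA : MeasurableSet A) (hPA : P A < 1) {D : ℝ}
    (hD : ∀ Y ∈ feasible P ξ μ ρ₀ A, D ≤ ∫ ω, ξ ω * Y ω ∂P) {x : ℝ} (hx : x ∈ Ioc (0 : ℝ) 1) :
    (tailMass P ξ A (P.real Aᶜ * x)).toReal ≤
      -D / ρ₀ * (cumSpectrum μ (P.real Aᶜ * x)).toReal := by
  have hα := measureReal_compl_pos hA hPA
  have := cond_isProbabilityMeasure (measure_compl_ne_zero hA hPA)
  have hfull := tailMass_le_of_forall_feasible hξ hξ0 hi hμ hρ₀ hD hA.compl Subset.rfl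
    fun s => Or.inr inter_subset_left
  -- At x = 1 the quantile level 1 - x = 0 leaves (0,1); there Aᶜ itself is the test set.
  rcases hx.2.eq_or_lt with rfl | hx1
  · rwa [mul_one]
  -- The sign is needed for concavity to survive multiplication by -D/ρ₀.
  have hN0 : 0 ≤ -D / ρ₀ := by
    by_contra! h
    have := mul_neg_of_neg_of_pos h (cumSpectrum_toReal_pos hμ hα)
    linarith [ENNReal.toReal_nonneg (a := tailMass P ξ A (P.real Aᶜ))]
  have hxI : x ∈ Ioo (0 : ℝ) 1 := ⟨hx.1, hx1⟩
  set c := quantile (cond P Aᶜ) ξ (1 - x) with hc_def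
  have hc : 0 ≤ c := quantile_nonneg hξ (ae_cond_nonneg hξ0) hxI
  have hp1 : P.real (Aᶜ ∩ {ω | c < ξ ω}) ≤ P.real Aᶜ * x := by
    rw [measureReal_inter_eq hA hPA]
    gcongr
    rw [← not_lt, ← lt_quantile_one_sub_iff hξ hxI]
    exact lt_irrefl _
  have hp2 : P.real Aᶜ * x ≤ P.real (Aᶜ ∩ {ω | c ≤ ξ ω}) := by
    rw [measureReal_inter_eq hA hPA]
    gcongr
    exact le_measureReal_quantile_le hξ hxI
  have h1 := tailMass_le_of_forall_feasible hξ hξ0 hi hμ hρ₀ hD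
    (hA.compl.inter (measurableSet_lt (measurable_const (a := c)) hξ)) inter_subset_left fun s => by
      rcases le_total s c with h | h
      · exact Or.inl fun ω hω => lt_of_le_of_lt h hω.2
      · exact Or.inr (inter_subset_inter_right _ fun ω (hω : s < ξ ω) => lt_of_le_of_lt h hω)
  have h2 := tailMass_le_of_forall_feasible hξ hξ0 hi hμ hρ₀ hD
    (hA.compl.inter (measurableSet_le (measurable_const (a := c)) hξ)) inter_subset_left fun s => by
      rcases lt_or_ge s c with h | h
      · exact Or.inl fun ω hω => lt_of_lt_of_le h hω.2
      · exact Or.inr (inter_subset_inter_right _ fun ω (hω : s < ξ ω) => h.trans hω.le)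
  have haff : ∀ y, P.real (Aᶜ ∩ {ω | c < ξ ω}) ≤ y → y ≤ P.real (Aᶜ ∩ {ω | c ≤ ξ ω}) →
      (tailMass P ξ A y).toReal =
        c * y + (∫⁻ s in Ici c, P (Aᶜ ∩ {ω | s < ξ ω})).toReal := by
    intro y hy1 hy2
    have hfin := (tailMass_lt_top (A := A) hξ hξ0 hi y).ne
    rw [tailMass_affine hc hy1 hy2] at hfin ⊢
    rw [ENNReal.toReal_add ENNReal.ofReal_ne_top (ENNReal.add_ne_top.1 hfin).2,
      ENNReal.toReal_ofReal (mul_nonneg hc (measureReal_nonneg.trans hy1))]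
  rw [haff _ le_rfl (hp1.trans hp2)] at h1
  rw [haff _ (hp1.trans hp2) le_rfl] at h2
  rw [haff _ hp1 hp2]
  set R := (∫⁻ s in Ici c, P (Aᶜ ∩ {ω | s < ξ ω})).toReal
  -- Concave minus affine: nonnegative at both ends of the gap, hence inside it.
  have hconc : ConcaveOn ℝ (Ici 0) fun y => -D / ρ₀ * (cumSpectrum μ y).toReal - (c * y + R) := by
    refine ((concaveOn_cumSpectrum hμ).smul hN0).sub ⟨convex_Ici 0, fun x _ y _ a b _ _ hab => ?_⟩
    simp only [smul_eq_mul]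
    exact le_of_eq (by linear_combination (-R) * hab)
  have hmin := hconc.min_le_of_mem_Icc (measureReal_nonneg (μ := P))
    (measureReal_nonneg (μ := P)) ⟨hp1, hp2⟩
  have hge : 0 ≤ -D / ρ₀ * (cumSpectrum μ (P.real Aᶜ * x)).toReal - (c * (P.real Aᶜ * x) + R) :=
    le_trans (le_min (sub_nonneg.2 h1) (sub_nonneg.2 h2)) hmin
  linarith

end Duality

/-! ### Bounds for the ratio, attainment of its supremum, and the criterion at 0 -/

section Ratio

variable {Ω : Type*} [MeasurableSpace Ω] {P : Measure Ω} [IsProbabilityMeasure P] {ξ : Ω → ℝ}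
  {A : Set Ω} {μ : Measure ℝ} [IsProbabilityMeasure μ] {ρ₀ : ℝ}

theorem ratio_nonneg (hξ : Measurable ξ) (hξ0 : ∀ᵐ ω ∂P, 0 ≤ ξ ω) (hi : Integrable ξ P)
    (hμ : ∀ᵐ β ∂μ, β ∈ Ioc (0 : ℝ) 1) (hA : MeasurableSet A) (hPA : P A < 1) {x : ℝ}
    (hx : x ∈ Icc (0 : ℝ) 1) : 0 ≤ ratio P ξ μ A x := by
  rw [ratio_eq hξ hξ0 hi hμ hA hPA hx]
  positivity

theorem ratio_le_of_forall_feasible (hξ : Measurable ξ) (hξ0 : ∀ᵐ ω ∂P, 0 ≤ ξ ω)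
    (hi : Integrable ξ P) (hμ : ∀ᵐ β ∂μ, β ∈ Ioc (0 : ℝ) 1) (hρ₀ : 0 < ρ₀)
    (hA : MeasurableSet A) (hPA : P A < 1) {D : ℝ}
    (hD : ∀ Y ∈ feasible P ξ μ ρ₀ A, D ≤ ∫ ω, ξ ω * Y ω ∂P) {x : ℝ} (hx : x ∈ Ioc (0 : ℝ) 1) :
    ratio P ξ μ A x ≤ -D / ρ₀ := by
  rw [ratio_eq hξ hξ0 hi hμ hA hPA (Ioc_subset_Icc_self hx),
    div_le_iff₀ (cumSpectrum_toReal_pos hμ (mul_pos (measureReal_compl_pos hA hPA) hx.1))]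
  exact tailMass_le hξ hξ0 hi hμ hρ₀ hA hPA hD hx

theorem le_Delta_of_ratio_le (hξ : Measurable ξ) (hξ0 : ∀ᵐ ω ∂P, 0 ≤ ξ ω)
    (hi : Integrable ξ P) (hμ : ∀ᵐ β ∂μ, β ∈ Ioc (0 : ℝ) 1) (hρ₀ : 0 < ρ₀)
    (hA : MeasurableSet A) (hPA : P A < 1) {N : ℝ}
    (hN : ∀ x ∈ Ioc (0 : ℝ) 1, ratio P ξ μ A x ≤ N) :
    ((-ρ₀ * N : ℝ) : EReal) ≤ Delta P ξ μ ρ₀ A := by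
  have hα := measureReal_compl_pos hA hPA
  have hN0 : 0 ≤ N := (ratio_nonneg hξ hξ0 hi hμ hA hPA ⟨zero_le_one, le_rfl⟩).trans
    (hN 1 ⟨one_pos, le_rfl⟩)
  refine le_iInf₂ fun Y hY => ?_
  rw [EReal.coe_le_coe_iff, neg_mul]
  refine le_integral_of_mem_feasible hξ hξ0 hi hμ hρ₀ hN0 (fun y hy => ?_) hY
  have hx : y / P.real Aᶜ ∈ Ioc (0 : ℝ) 1 := ⟨div_pos hy.1 hα, (div_le_one hα).2 hy.2⟩
  have := hN _ hx
  rwa [ratio_eq hξ hξ0 hi hμ hA hPA (Ioc_subset_Icc_self hx), mul_div_cancel₀ _ hα.ne',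
    div_le_iff₀ (cumSpectrum_toReal_pos hμ hy.1)] at this

theorem measureReal_mul_mem_Icc {x : ℝ} (hx : x ∈ Icc (0 : ℝ) 1) (B : Set Ω) :
    P.real B * x ∈ Icc (0 : ℝ) 1 :=
  ⟨mul_nonneg measureReal_nonneg hx.1, mul_le_one₀ measureReal_le_one hx.1 hx.2⟩

theorem continuousOn_ratio (hξ : Measurable ξ) (hξ0 : ∀ᵐ ω ∂P, 0 ≤ ξ ω) (hi : Integrable ξ P)
    (hμ : ∀ᵐ β ∂μ, β ∈ Ioc (0 : ℝ) 1) (hA : MeasurableSet A) (hPA : P A < 1) :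
    ContinuousOn (ratio P ξ μ A) (Ioc 0 1) := by
  have hα := measureReal_compl_pos hA hPA
  have h1 : ContinuousOn (fun x => ∫ u in (0 : ℝ)..x, condQuantile P ξ A (1 - u)) (Icc 0 1) := by
    have := intervalIntegral.continuousOn_primitive_interval (μ := volume) (a := 0) (b := 1)
      (f := fun u => condQuantile P ξ A (1 - u))
      (by rw [uIcc_of_le zero_le_one]; exact integrableOn_condQuantile hξ hξ0 hi hA hPA)
    rwa [uIcc_of_le zero_le_one] at this
  have h2 : ContinuousOn (fun x => ∫ u in (0 : ℝ)..x, spectrum μ u) (Icc 0 1) := by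
    have := intervalIntegral.continuousOn_primitive_interval (μ := volume) (a := 0) (b := 1)
      (f := spectrum μ)
      (by rw [uIcc_of_le zero_le_one, integrableOn_Icc_iff_integrableOn_Ioc]
          exact integrableOn_spectrum hμ 1)
    rwa [uIcc_of_le zero_le_one] at this
  have h3 : ContinuousOn (fun x => ∫ u in (0 : ℝ)..(P.real Aᶜ * x), spectrum μ u) (Icc 0 1) :=
    h2.comp (f := fun x => P.real Aᶜ * x) (by fun_prop) fun x hx => measureReal_mul_mem_Icc hx _
  refine ContinuousOn.mul (continuousOn_const.div (h3.mono Ioc_subset_Icc_self) fun x hx => ?_)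
    (h1.mono Ioc_subset_Icc_self)
  rw [integral_spectrum hμ (mul_pos hα hx.1).le]
  exact (cumSpectrum_toReal_pos hμ (mul_pos hα hx.1)).ne'

/-- Either the upper limit at 0 equals the supremum, or the ratio stays below some c < M near 0 and
compactness of the remaining interval yields a maximizer. -/
theorem exists_isGreatest_r (hξ : Measurable ξ) (hξ0 : ∀ᵐ ω ∂P, 0 ≤ ξ ω) (hi : Integrable ξ P)
    (hμ : ∀ᵐ β ∂μ, β ∈ Ioc (0 : ℝ) 1) (hA : MeasurableSet A) (hPA : P A < 1)
    (hbdd : BddAbove (ratio P ξ μ A '' Ioc 0 1)) :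
    IsGreatest (r P ξ μ A '' Icc (0 : ℝ) 1) ((sSup (ratio P ξ μ A '' Ioc 0 1) : ℝ) : EReal) := by
  set M := sSup (ratio P ξ μ A '' Ioc 0 1)
  have hle : ∀ x ∈ Ioc (0 : ℝ) 1, ratio P ξ μ A x ≤ M := fun x hx =>
    le_csSup hbdd (mem_image_of_mem _ hx)
  have hr0 : r P ξ μ A 0 = limsup (fun y : ℝ => ((ratio P ξ μ A y : ℝ) : EReal)) (𝓝[>] 0) :=
    if_pos rfl
  have hr : ∀ x : ℝ, 0 < x → r P ξ μ A x = ((ratio P ξ μ A x : ℝ) : EReal) := fun x hx =>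
    if_neg hx.ne'
  have hlim : limsup (fun y : ℝ => ((ratio P ξ μ A y : ℝ) : EReal)) (𝓝[>] 0) ≤ (M : EReal) := by
    refine limsup_le_of_le (h := ?_)
    filter_upwards [Ioc_mem_nhdsGT one_pos] with y hy
    exact_mod_cast hle y hy
  constructor
  · rcases hlim.eq_or_lt with h | h
    · exact ⟨0, ⟨le_rfl, zero_le_one⟩, hr0.trans h⟩
    obtain ⟨c, hc1, hc2⟩ := EReal.lt_iff_exists_real_btwn.1 h
    have hcM : c < M := by exact_mod_cast hc2
    obtain ⟨δ, hδ, hδc⟩ := mem_nhdsGT_iff_exists_Ioo_subset.1 (eventually_lt_of_limsup_lt hc1)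
    have hδ : 0 < δ := hδ
    have hpos : 0 < min δ 1 := lt_min hδ one_pos
    obtain ⟨x, hx, hmax⟩ := (isCompact_Icc (a := min δ 1) (b := 1)).exists_isMaxOn
      ⟨1, min_le_right _ _, le_rfl⟩ ((continuousOn_ratio hξ hξ0 hi hμ hA hPA).mono fun y hy =>
        ⟨hpos.trans_le hy.1, hy.2⟩)
    have hx0 : 0 < x := hpos.trans_le hx.1
    refine ⟨x, ⟨hx0.le, hx.2⟩, ?_⟩
    rw [hr x hx0, EReal.coe_eq_coe_iff]
    refine le_antisymm (hle x ⟨hx0, hx.2⟩) ?_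
    by_contra! hlt
    -- Otherwise the larger of c and the compact maximum would be an upper bound below M.
    refine absurd (csSup_le ((nonempty_Ioc.2 one_pos).image _) ?_) (not_le.2 (max_lt hcM hlt))
    rintro _ ⟨y, hy, rfl⟩
    rcases lt_or_ge y (min δ 1) with h1 | h1
    · have : ((ratio P ξ μ A y : ℝ) : EReal) < (c : EReal) :=
        hδc ⟨hy.1, h1.trans_le (min_le_left _ _)⟩
      exact le_max_of_le_left (by exact_mod_cast this.le)
    · exact le_max_of_le_right (hmax ⟨h1, hy.2⟩)
  · rintro _ ⟨x, hx, rfl⟩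
    rcases hx.1.eq_or_lt with h | h
    · rw [← h, hr0]
      exact hlim
    · rw [hr x h]
      exact_mod_cast hle x ⟨h, hx.2⟩

/-- Zeros of the decreasing φ arbitrarily near 0 would make it vanish on (0,1], against G(1) > 0. So
the quotient in (i) is genuine near 0. -/
theorem exists_spectrum_pos (hμ : ∀ᵐ β ∂μ, β ∈ Ioc (0 : ℝ) 1) :
    ∃ η > 0, ∀ u ∈ Ioc 0 η, 0 < spectrum μ u := by
  by_contra! h
  refine cumSpectrum_pos hμ one_pos ?_
  rw [← lintegral_spectrum hμ, setLIntegral_congr_fun (g := 0) measurableSet_Ioc]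
  · simp
  · intro u hu
    obtain ⟨v, hv, hv0⟩ := h u hu.1
    exact ENNReal.ofReal_of_nonpos ((antitoneOn_spectrum hv.1 hu.1 hv.2).trans hv0)

/-- Concavity together with G(0) = 0. -/
theorem mul_cumSpectrum_le (hμ : ∀ᵐ β ∂μ, β ∈ Ioc (0 : ℝ) 1) {a x : ℝ} (ha : a ∈ Icc (0 : ℝ) 1)
    (hx : 0 ≤ x) : a * (cumSpectrum μ x).toReal ≤ (cumSpectrum μ (a * x)).toReal := by
  have := (concaveOn_cumSpectrum hμ).2 (mem_Ici.2 hx) (mem_Ici.2 le_rfl) ha.1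
    (sub_nonneg.2 ha.2) (add_sub_cancel _ _)
  simpa [cumSpectrum_zero] using this

theorem intervalIntegrable_condQuantile (hξ : Measurable ξ) (hξ0 : ∀ᵐ ω ∂P, 0 ≤ ξ ω)
    (hi : Integrable ξ P) (hA : MeasurableSet A) (hPA : P A < 1) {x : ℝ} (hx : x ∈ Icc (0 : ℝ) 1) :
    IntervalIntegrable (fun u => condQuantile P ξ A (1 - u)) volume 0 x := by
  rw [intervalIntegrable_iff_integrableOn_Icc_of_le hx.1]
  exact (integrableOn_condQuantile hξ hξ0 hi hA hPA).mono_set (Icc_subset_Icc_right hx.2)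

theorem intervalIntegrable_spectrum (hμ : ∀ᵐ β ∂μ, β ∈ Ioc (0 : ℝ) 1) {x : ℝ} (hx : 0 ≤ x) :
    IntervalIntegrable (spectrum μ) volume 0 x := by
  rw [intervalIntegrable_iff_integrableOn_Ioc_of_le hx]
  exact integrableOn_spectrum hμ x

theorem exists_ratio_le_of_tendsto (hξ : Measurable ξ) (hξ0 : ∀ᵐ ω ∂P, 0 ≤ ξ ω)
    (hi : Integrable ξ P) (hμ : ∀ᵐ β ∂μ, β ∈ Ioc (0 : ℝ) 1) (hA : MeasurableSet A)
    (hPA : P A < 1) {ℓ : EReal}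
    (hℓ : Tendsto (fun x : ℝ => ((condQuantile P ξ A (1 - x) / spectrum μ x : ℝ) : EReal))
      (𝓝[>] 0) (𝓝 ℓ)) (htop : ℓ < ⊤) :
    ∃ N : ℝ, ∀ x ∈ Ioc (0 : ℝ) 1, ratio P ξ μ A x ≤ N := by
  have hα := measureReal_compl_pos hA hPA
  obtain ⟨C, hC, -⟩ := EReal.lt_iff_exists_real_btwn.1 htop
  obtain ⟨η, hη, hpos⟩ := exists_spectrum_pos hμ
  obtain ⟨δ, hδ, hsub⟩ := mem_nhdsGT_iff_exists_Ioo_subset.1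
    ((hℓ.eventually_lt_const hC).and (Ioc_mem_nhdsGT hη))
  have hδ : 0 < δ := hδ
  have hC0 : ∀ u ∈ Ioo 0 δ, condQuantile P ξ A (1 - u) ≤ C * spectrum μ u := fun u hu => by
    obtain ⟨h1, h2⟩ := hsub hu
    have h1 : condQuantile P ξ A (1 - u) / spectrum μ u < C := by exact_mod_cast h1
    exact ((div_lt_iff₀ (hpos u h2)).1 h1).le
  -- For x < δ the pointwise bound by C integrates; for x ≥ δ the numerator is at most T(α) and the
  -- denominator at least G(αδ).
  refine ⟨max |C| ((tailMass P ξ A (P.real Aᶜ)).toReal /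
    (cumSpectrum μ (P.real Aᶜ * δ)).toReal), fun x hx => ?_⟩
  have hxI := Ioc_subset_Icc_self hx
  rw [ratio_eq hξ hξ0 hi hμ hA hPA hxI]
  rcases lt_or_ge x δ with h | h
  · refine le_max_of_le_left ?_
    rw [div_le_iff₀ (cumSpectrum_toReal_pos hμ (mul_pos hα hx.1)),
      ← integral_condQuantile hξ hξ0 hi hA hPA hxI]
    calc P.real Aᶜ * ∫ u in (0 : ℝ)..x, condQuantile P ξ A (1 - u)
        ≤ P.real Aᶜ * ∫ u in (0 : ℝ)..x, |C| * spectrum μ u := by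
          refine mul_le_mul_of_nonneg_left ?_ hα.le
          refine intervalIntegral.integral_mono_on_of_le_Ioo hx.1.le
            (intervalIntegrable_condQuantile hξ hξ0 hi hA hPA hxI)
            ((intervalIntegrable_spectrum hμ hx.1.le).const_mul _) fun u hu => ?_
          exact (hC0 u ⟨hu.1, hu.2.trans h⟩).trans
            (mul_le_mul_of_nonneg_right (le_abs_self C) (spectrum_nonneg μ hu.1.le))
      _ = |C| * (P.real Aᶜ * (cumSpectrum μ x).toReal) := by
          rw [intervalIntegral.integral_const_mul, integral_spectrum hμ hx.1.le]
          ring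
      _ ≤ |C| * (cumSpectrum μ (P.real Aᶜ * x)).toReal :=
          mul_le_mul_of_nonneg_left
            (mul_cumSpectrum_le hμ ⟨hα.le, measureReal_le_one⟩ hx.1.le) (abs_nonneg C)
  · refine le_max_of_le_right (div_le_div₀ ENNReal.toReal_nonneg ?_
      (cumSpectrum_toReal_pos hμ (mul_pos hα hδ)) ?_)
    · exact ENNReal.toReal_mono (tailMass_lt_top hξ hξ0 hi _).ne
        (tailMass_mono (mul_le_of_le_one_right hα.le hx.2))
    · exact ENNReal.toReal_mono (cumSpectrum_ne_top hμ _)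
        (monotone_cumSpectrum μ (mul_le_mul_of_nonneg_left h hα.le))

theorem lt_top_of_tendsto_of_ratio_le (hξ : Measurable ξ) (hξ0 : ∀ᵐ ω ∂P, 0 ≤ ξ ω)
    (hi : Integrable ξ P) (hμ : ∀ᵐ β ∂μ, β ∈ Ioc (0 : ℝ) 1) (hA : MeasurableSet A)
    (hPA : P A < 1) {ℓ : EReal}
    (hℓ : Tendsto (fun x : ℝ => ((condQuantile P ξ A (1 - x) / spectrum μ x : ℝ) : EReal))
      (𝓝[>] 0) (𝓝 ℓ)) {N : ℝ} (hN : ∀ x ∈ Ioc (0 : ℝ) 1, ratio P ξ μ A x ≤ N) : ℓ < ⊤ := by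
  have hα := measureReal_compl_pos hA hPA
  have hN0 : 0 ≤ N := (ratio_nonneg hξ hξ0 hi hμ hA hPA ⟨zero_le_one, le_rfl⟩).trans
    (hN 1 ⟨one_pos, le_rfl⟩)
  refine lt_top_iff_ne_top.2 fun htop => ?_
  rw [htop] at hℓ
  -- Chosen so that integrating the pointwise bound forces the ratio up to N + 1 at min(δ, 1).
  set C := (N + 1) / P.real Aᶜ with hC
  have hCpos : 0 < C := by positivity
  obtain ⟨δ, hδ, hsub⟩ := mem_nhdsGT_iff_exists_Ioo_subset.1
    (hℓ.eventually_const_lt (EReal.coe_lt_top C))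
  have hδ : 0 < δ := hδ
  have hq : ∀ u ∈ Ioo 0 δ, C * spectrum μ u ≤ condQuantile P ξ A (1 - u) := fun u hu => by
    have h1 : (C : EReal) < ((condQuantile P ξ A (1 - u) / spectrum μ u : ℝ) : EReal) := hsub hu
    have h1 : C < condQuantile P ξ A (1 - u) / spectrum μ u := by exact_mod_cast h1
    -- Where φ(u) = 0 the quotient is 0 by the convention for division, which cannot exceed C > 0.
    rcases (spectrum_nonneg μ hu.1.le).eq_or_lt with h | h
    · rw [← h, div_zero] at h1
      exact absurd h1 (not_lt.2 hCpos.le)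
    · exact ((lt_div_iff₀ h).1 h1).le
  have hx : min δ 1 ∈ Ioc (0 : ℝ) 1 := ⟨lt_min hδ one_pos, min_le_right _ _⟩
  have hxI := Ioc_subset_Icc_self hx
  have h1 := hN _ hx
  rw [ratio_eq hξ hξ0 hi hμ hA hPA hxI, div_le_iff₀
    (cumSpectrum_toReal_pos hμ (mul_pos hα hx.1)), ← integral_condQuantile hξ hξ0 hi hA hPA hxI]
    at h1
  have h2 : (N + 1) * (cumSpectrum μ (P.real Aᶜ * min δ 1)).toReal ≤
      P.real Aᶜ * ∫ u in (0 : ℝ)..(min δ 1), condQuantile P ξ A (1 - u) := by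
    calc (N + 1) * (cumSpectrum μ (P.real Aᶜ * min δ 1)).toReal
        ≤ (N + 1) * (cumSpectrum μ (min δ 1)).toReal := by
          refine mul_le_mul_of_nonneg_left (ENNReal.toReal_mono (cumSpectrum_ne_top hμ _)
            (monotone_cumSpectrum μ (mul_le_of_le_one_left hx.1.le measureReal_le_one)))
            (by positivity)
      _ = P.real Aᶜ * ∫ u in (0 : ℝ)..(min δ 1), C * spectrum μ u := by
          rw [intervalIntegral.integral_const_mul, integral_spectrum hμ hx.1.le, hC]
          field_simp
      _ ≤ _ := by
          refine mul_le_mul_of_nonneg_left ?_ hα.le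
          exact intervalIntegral.integral_mono_on_of_le_Ioo hx.1.le
            ((intervalIntegrable_spectrum hμ hx.1.le).const_mul _)
            (intervalIntegrable_condQuantile hξ hξ0 hi hA hPA hxI)
            fun u hu => hq u ⟨hu.1, hu.2.trans_le (min_le_left _ _)⟩
  have := cumSpectrum_toReal_pos hμ (mul_pos hα hx.1)
  linarith

end Ratio

end SpectralRisk

/-! ### The lemma itself -/

theorem lemma4p1 {Ω : Type*} [MeasurableSpace Ω] (P : Measure Ω) [IsProbabilityMeasure P]
    (ξ : Ω → ℝ) (hξ_meas : Measurable ξ) (hξ_nonneg : ∀ᵐ ω ∂P, 0 ≤ ξ ω)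
    (hξ_mean : ∫ ω, ξ ω ∂P = 1)
    (μ : Measure ℝ) [IsProbabilityMeasure μ] (hμ : μ (Icc (0 : ℝ) 1)ᶜ = 0) (hμ_zero : μ {0} = 0)
    (ρ₀ : ℝ) (hρ₀ : SpectralRisk.spectralRisk P μ (fun _ => 0) < (ρ₀ : EReal))
    (A : Set Ω) (hA : MeasurableSet A) (hPA : P A < 1) :
    (∀ ℓ : EReal,
      Tendsto (fun x : ℝ =>
        ((SpectralRisk.condQuantile P ξ A (1 - x) / SpectralRisk.spectrum μ x : ℝ) : EReal))
        (𝓝[>] 0) (𝓝 ℓ) →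
      ((SpectralRisk.Delta P ξ μ ρ₀ A ≠ ⊥ ∧ SpectralRisk.Delta P ξ μ ρ₀ A ≠ ⊤) ↔ ℓ < ⊤)) ∧
    ((SpectralRisk.Delta P ξ μ ρ₀ A ≠ ⊥ ∧ SpectralRisk.Delta P ξ μ ρ₀ A ≠ ⊤) →
      ∃ M : ℝ, IsGreatest (SpectralRisk.r P ξ μ A '' Icc (0 : ℝ) 1) (M : EReal) ∧
        SpectralRisk.Delta P ξ μ ρ₀ A = ((-ρ₀ * M : ℝ) : EReal)) := by
  -- A non-integrable ξ would have integral 0 by convention, not 1.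
  have hi : Integrable ξ P := by
    by_contra h
    rw [integral_undef h] at hξ_mean
    exact zero_ne_one hξ_mean
  have hμ' : ∀ᵐ β ∂μ, β ∈ Ioc (0 : ℝ) 1 := by
    have h0 : ∀ᵐ β ∂μ, β ∈ Icc (0 : ℝ) 1 := hμ
    have h1 : ∀ᵐ β ∂μ, β ≠ 0 := by simpa [ae_iff] using hμ_zero
    filter_upwards [h0, h1] with β hβ hβ0
    exact ⟨lt_of_le_of_ne hβ.1 (Ne.symm hβ0), hβ.2⟩
  have hρ : 0 < ρ₀ := by
    rw [SpectralRisk.spectralRisk_eq hμ' aemeasurable_const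
      (Eventually.of_forall fun _ => le_rfl)] at hρ₀
    exact_mod_cast (EReal.coe_ennreal_nonneg _).trans_lt hρ₀
  have hfin : ∀ {D : ℝ}, SpectralRisk.Delta P ξ μ ρ₀ A = D → ∀ x ∈ Ioc (0 : ℝ) 1,
      SpectralRisk.ratio P ξ μ A x ≤ -D / ρ₀ := fun {D} hD x hx => by
    refine SpectralRisk.ratio_le_of_forall_feasible hξ_meas hξ_nonneg hi hμ' hρ hA hPA
      (fun Y hY => ?_) hx
    have : SpectralRisk.Delta P ξ μ ρ₀ A ≤ ((∫ ω, ξ ω * Y ω ∂P : ℝ) : EReal) := iInf₂_le Y hY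
    rw [hD] at this
    exact_mod_cast this
  -- Y = 0 is feasible, so only the value -∞ has to be excluded.
  have hne : SpectralRisk.Delta P ξ μ ρ₀ A ≠ ⊤ := by
    refine ne_top_of_le_ne_top (EReal.coe_ne_top _) (iInf₂_le (fun _ => (0 : ℝ)) ?_)
    exact ⟨aemeasurable_const, by simp, hρ₀.le, by simp, by simp⟩
  refine ⟨fun ℓ hℓ => ⟨fun ⟨hbot, _⟩ => ?_, fun htop => ⟨?_, hne⟩⟩, fun ⟨hbot, _⟩ => ?_⟩
  · exact SpectralRisk.lt_top_of_tendsto_of_ratio_le hξ_meas hξ_nonneg hi hμ' hA hPA hℓ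
      (hfin (EReal.coe_toReal hne hbot).symm)
  · obtain ⟨N, hN⟩ := SpectralRisk.exists_ratio_le_of_tendsto
      hξ_meas hξ_nonneg hi hμ' hA hPA hℓ htop
    exact ne_bot_of_le_ne_bot (EReal.coe_ne_bot _)
      (SpectralRisk.le_Delta_of_ratio_le hξ_meas hξ_nonneg hi hμ' hρ hA hPA hN)
  · have hD := (EReal.coe_toReal hne hbot).symm
    have hub : ∀ y ∈ SpectralRisk.ratio P ξ μ A '' Ioc 0 1,
        y ≤ -(SpectralRisk.Delta P ξ μ ρ₀ A).toReal / ρ₀ := by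
      rintro _ ⟨x, hx, rfl⟩
      exact hfin hD x hx
    refine ⟨sSup (SpectralRisk.ratio P ξ μ A '' Ioc 0 1),
      SpectralRisk.exists_isGreatest_r hξ_meas hξ_nonneg hi hμ' hA hPA ⟨_, hub⟩,
      le_antisymm ?_ (SpectralRisk.le_Delta_of_ratio_le hξ_meas hξ_nonneg hi hμ' hρ hA hPA
        fun x hx => le_csSup ⟨_, hub⟩ (mem_image_of_mem _ hx))⟩
    have hM := csSup_le ((nonempty_Ioc.2 one_pos).image _) hub
    rw [le_div_iff₀ hρ] at hM
    rw [hD, EReal.coe_le_coe_iff]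
    linarith
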